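/- For a probability distribution $P$ on $\mathbb{R}$ with finite second moment let $\mu_P$ and $\sigma_P^2$ be its mean and variance. Let $\mathcal{P}$ be a family of such distributions, $n\ge 1$ an integer, $L>0$ and $\delta_{\min}\in(0,1)$. A *$\delta$-dependent $L$-sub-Gaussian estimator* for $(\mathcal{P},n,\delta_{\min})$ is a measurable map $\widehat E_n:\mathbb{R}^n\times[\delta_{\min},1)\to\mathbb{R}$ such that for all $P\in\mathcal{P}$ and $\delta\in[\delta_{\min},1)$, if $X_1^n=(X_1,\dots,X_n)$ is i.i.d. with law $P$, then $$\Pr\left(|\widehat E_n(X_1^n,\delta)-\mu_P|>L\,\sigma_P\sqrt{\frac{1+\ln(1/\delta)}{n}}\right)\le\delta .$$ A *multiple-$\delta$ $L$-sub-Gaussian estimator* for $(\mathcal{P},n,\delta_{\min})$ is a measurable map $\widehat E_n:\mathbb{R}^n\to\mathbb{R}$, not depending on $\delta$, that satisfies the same inequality (with $\widehat E_n(X_1^n)$ in place of $\widehat E_n(X_1^n,\delta)$) for all $P\in\mathcal{P}$ and all $\delta\in[\delta_{\min},1)$. **Theorem 2.** For $0<\sigma_1\le\sigma_2<\infty$ let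 $\mathcal{P}_2^{[\sigma_1^2,\sigma_2^2]}$ be the class of all distributions on $\mathbb{R}$ with finite second moment and variance in $[\sigma_1^2,\sigma_2^2]$, and let $R=\sigma_2/\sigma_1\ge 1$. 1. For all such $\sigma_1,\sigma_2$ and every $n\ge 6$ there exists a multiple-$\delta$ $L^{(1)}$-sub-Gaussian estimator for $(\mathcal{P}_2^{[\sigma_1^2,\sigma_2^2]},n,\delta^{(1)}_{\min})$, where $L^{(1)}=(4e\sqrt{2+4\ln 2})\,R$ and $\delta^{(1)}_{\min}=4e^{1-n/2}$. 2. For every $L\ge\sqrt2$ there exist $\phi^{(2)}>0$ and $\delta^{(2)}_{\min}\in(0,1)$, depending only on $L$, such that whenever $R>\phi^{(2)}$ there is no multiple-$\delta$ $L$-sub-Gaussian estimator for $(\mathcal{P}_2^{[\sigma_1^2,\sigma_2^2]},n,\delta^{(2)}_{\min})$ for any $n\ge 1$. 3. For every value of $R\ge 1$, every $L\ge\sqrt2$ and every $n\ge 1$, there is no $\delta$-dependent $L$-sub-Gaussian estimator for $(\mathcal{P}_2^{[\sigma_1^2,\sigma_2^2]},n,\delta^{(3)}_{\min})$, where $\delta^{(3)}_{\min}=e^{1-5L^2n}$.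 -/

import Mathlib

open MeasureTheory Set

noncomputable section

namespace SubGaussianMean

/-- The mean `μ_P` of a distribution on the real line. -/
def mean (P : ProbabilityMeasure ℝ) : ℝ := ∫ x, x ∂(P : Measure ℝ)

/-- The variance `σ_P²` of a distribution on the real line. -/
def var (P : ProbabilityMeasure ℝ) : ℝ :=
  ProbabilityTheory.variance (fun x : ℝ => x) (P : Measure ℝ)

/-- The standard deviation `σ_P`. -/
def std (P : ProbabilityMeasure ℝ) : ℝ := √(var P)

/-- The law `P^{⊗n}` on `ℝⁿ` of an i.i.d. sample of size `n` from `P`. -/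
def sampleLaw (P : ProbabilityMeasure ℝ) (n : ℕ) : Measure (Fin n → ℝ) :=
  Measure.pi fun _ => (P : Measure ℝ)

/-- All distributions on the real line with finite second moment. -/
def finiteSecondMoment : Set (ProbabilityMeasure ℝ) :=
  {P | MemLp (fun x : ℝ => x) 2 (P : Measure ℝ)}

/-- All distributions with finite second moment and variance in `[σ₁², σ₂²]`. -/
def varianceClass (σ₁ σ₂ : ℝ) : Set (ProbabilityMeasure ℝ) :=
  {P | P ∈ finiteSecondMoment ∧ σ₁ ^ 2 ≤ var P ∧ var P ≤ σ₂ ^ 2}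

/-- The sub-Gaussian deviation `L σ_P √((1 + ln (1/δ)) / n)`. -/
def radius (L : ℝ) (P : ProbabilityMeasure ℝ) (n : ℕ) (δ : ℝ) : ℝ :=
  L * std P * √((1 + Real.log (1 / δ)) / n)

/-- `E` is a `δ`-dependent `L`-sub-Gaussian estimator for `(F, n, δmin)`: a measurable map
`ℝⁿ × [δmin, 1) → ℝ` such that `E (·, δ)` has the sub-Gaussian deviation at level `δ`. -/
def IsDeltaDependentSubGaussian (L : ℝ) (F : Set (ProbabilityMeasure ℝ)) (n : ℕ) (δmin : ℝ)
    (E : (Fin n → ℝ) × Ico δmin 1 → ℝ) : Prop :=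
  Measurable E ∧ ∀ P ∈ F, ∀ δ : Ico δmin 1,
    (sampleLaw P n).real {x | |E (x, δ) - mean P| > radius L P n δ} ≤ δ

/-- `E` is a multiple-`δ` `L`-sub-Gaussian estimator for `(F, n, δmin)`: a single measurable map
`ℝⁿ → ℝ` that has the sub-Gaussian deviation at every level `δ ∈ [δmin, 1)`. -/
def IsMultipleDeltaSubGaussian (L : ℝ) (F : Set (ProbabilityMeasure ℝ)) (n : ℕ) (δmin : ℝ)
    (E : (Fin n → ℝ) → ℝ) : Prop :=
  Measurable E ∧ ∀ δ ∈ Ico δmin 1, ∀ P ∈ F,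
    (sampleLaw P n).real {x | |E x - mean P| > radius L P n δ} ≤ δ

end SubGaussianMean

end

/-!
The three parts have independent proofs.

*Existence.* The median of the means of `b` blocks of length `⌊n / b⌋` misses the mean by more
than `2 e σ₂ √(2 b / n)` only if at least half of the block means do. By Chebyshev's inequality
each does with probability at most `1 / (4 e²)`, and they are independent, so the failure
probability is at most `e⁻ᵇ` (`exists_medianOfMeans`). Since `σ₂` is known, this gives for every
`b ≤ n` an explicit confidence interval that does not involve `δ`. One estimator serves all levels:
project a point successively onto the intervals for `b = 1, …, n`. If the intervals from the `b`-th
on all contain the mean, which fails with probability at most `2 e⁻ᵇ`, the point enters the `b`-th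
interval and is never moved away from the mean afterwards (`abs_projectionChain_sub_le`). Given
`δ`, take `b = ⌈ln (2 / δ)⌉`.

*No estimator for all levels when `R` is large.* Compare samples of Poisson laws of rates `1 / n`
and `c / n`, rescaled so that the variances are `σ₁²` and `c σ₁²`. Under the larger rate, an
estimator that is good at level `1/4` is close to the mean with probability at least `1/4` while
the total count is below `2 c`. The likelihood ratio there is at most `c ^ (2 c)`
(`pi_poissonMeasure_mul_le`), so under rate `1 / n` the same event keeps probability at least
`c ^ (-2 c) / 4`. On it the error is of order `c` (in units of `σ₁ / √n`), whereas the
deviation allowed at level `c ^ (-2 c) / 8` has order only `√(c ln c)`.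

*No `δ`-dependent estimator at very small levels.* Two laws with mass `κ` at `0` and the rest at
`a` or `-a` both produce the zero sample with probability `κⁿ`, and on it the estimator must fail
for one of them. With `κ = 1 / (2 + 5 L⁴)` and variance `σ₁²`, the means exceed the deviation
`√5 L² σ₁` allowed at level `exp (1 - 5 L² n)` in absolute value, and `κⁿ` exceeds this level
(`exists_twoPointLaw_fail`).
-/

namespace SubGaussianMean

open ProbabilityTheory NNReal

instance (P : ProbabilityMeasure ℝ) (n : ℕ) : IsProbabilityMeasure (sampleLaw P n) :=
  inferInstanceAs (IsProbabilityMeasure (Measure.pi fun _ : Fin n => (P : Measure ℝ)))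

/-! ### Two-point laws and the impossibility of very small confidence levels -/

/-- The law with mass `κ` at `0` and mass `1 - κ` at `a`. -/
noncomputable def twoPointLaw (a : ℝ) (κ : unitInterval) : ProbabilityMeasure ℝ :=
  ⟨bernoulliMeasure 0 a κ, inferInstance⟩

lemma coe_twoPointLaw (a : ℝ) (κ : unitInterval) :
    (twoPointLaw a κ : Measure ℝ) = bernoulliMeasure 0 a κ := rfl

lemma twoPointLaw_mem_finiteSecondMoment (a : ℝ) (κ : unitInterval) :
    twoPointLaw a κ ∈ finiteSecondMoment :=
  (memLp_two_iff_integrable_sq (by fun_prop)).2 (integrable_bernoulliMeasure _ _ _ _)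

lemma mean_twoPointLaw (a : ℝ) (κ : unitInterval) : mean (twoPointLaw a κ) = (1 - κ) * a := by
  simp [mean, coe_twoPointLaw, integral_bernoulliMeasure]

lemma var_twoPointLaw (a : ℝ) (κ : unitInterval) :
    var (twoPointLaw a κ) = κ * (1 - κ) * a ^ 2 := by
  rw [var, variance_eq_sub (twoPointLaw_mem_finiteSecondMoment a κ)]
  simp [coe_twoPointLaw, integral_bernoulliMeasure]
  ring

/-- The sample that is identically zero has probability `κⁿ`, whatever the second atom is. -/
lemma sampleLaw_twoPointLaw_zero {a : ℝ} (ha : a ≠ 0) (κ : unitInterval) (n : ℕ) :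
    (sampleLaw (twoPointLaw a κ) n).real {0} = (κ : ℝ) ^ n := by
  have h : (bernoulliMeasure 0 a κ) {(0 : ℝ)} = (unitInterval.toNNReal κ : ENNReal) :=
    bernoulliMeasure_apply_of_mem_of_notMem κ (measurableSet_singleton 0) rfl
      (by simpa using ha)
  simp [sampleLaw, coe_twoPointLaw, measureReal_def, h]

/-- Whatever value `m` is guessed on the zero sample, one of two opposite two-point laws of
variance `σ²` has its mean further from `m` than the deviation at level `exp (1 - 5 L² n)`, and
still gives that sample a larger probability than this level. -/
lemma exists_twoPointLaw_fail {L σ : ℝ} (hL : √2 ≤ L) (hσ : 0 < σ) {n : ℕ} (hn : 0 < n) (m : ℝ) :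
    ∃ P : ProbabilityMeasure ℝ, P ∈ finiteSecondMoment ∧ var P = σ ^ 2 ∧
      Real.exp (1 - 5 * L ^ 2 * n) < (sampleLaw P n).real {0} ∧
      radius L P n (Real.exp (1 - 5 * L ^ 2 * n)) < |m - mean P| := by
  have hL0 : 0 < L := lt_of_lt_of_le (by positivity) hL
  have hL2 : 2 ≤ L ^ 2 := by
    have := pow_le_pow_left₀ (Real.sqrt_nonneg 2) hL 2
    rwa [Real.sq_sqrt (by norm_num)] at this
  have hn1 : (1 : ℝ) ≤ n := by exact_mod_cast hn
  -- The mass `κ` makes `(1 - κ) / κ = 1 + 5 L⁴`, the squared ratio of mean and deviation.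
  obtain ⟨κ, hκ⟩ : ∃ κ : unitInterval, (κ : ℝ) = (2 + 5 * L ^ 4)⁻¹ :=
    ⟨⟨(2 + 5 * L ^ 4)⁻¹, by positivity, inv_le_one_of_one_le₀ (by nlinarith [sq_nonneg (L ^ 2)])⟩,
      rfl⟩
  have hκ0 : (0 : ℝ) < κ := by rw [hκ]; positivity
  have hκ' : 1 - (κ : ℝ) = κ * (1 + 5 * L ^ 4) := by rw [hκ]; field_simp; ring
  have hκ1 : 0 < 1 - (κ : ℝ) := by rw [hκ']; positivity
  have hκv : 0 < κ * (1 - κ : ℝ) := mul_pos hκ0 hκ1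
  set a : ℝ := σ / √(κ * (1 - κ)) with ha
  have ha0 : 0 < a := div_pos hσ (Real.sqrt_pos.2 hκv)
  have ha2 : κ * (1 - κ : ℝ) * a ^ 2 = σ ^ 2 := by
    rw [ha, div_pow, Real.sq_sqrt hκv.le]; field_simp
  have hmean : (L ^ 2 * √5 * σ) < (1 - κ) * a := by
    refine lt_of_pow_lt_pow_left₀ 2 (by positivity) ?_
    have h5 : √5 ^ 2 = (5 : ℝ) := Real.sq_sqrt (by norm_num)
    have : ((1 - κ : ℝ) * a) ^ 2 = (1 + 5 * L ^ 4) * σ ^ 2 := by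
      rw [← ha2, mul_pow]; nth_rw 1 [sq, hκ']; ring
    rw [this, mul_pow, mul_pow, h5]
    nlinarith [sq_pos_of_pos hσ]
  have hmass : Real.exp (1 - 5 * L ^ 2 * n) < (κ : ℝ) ^ n := by
    have hbase : Real.exp (1 - 5 * L ^ 2) < κ := by
      rw [hκ, ← neg_sub, Real.exp_neg]
      refine inv_strictAnti₀ (by positivity) ?_
      have := Real.quadratic_le_exp_of_nonneg (x := 5 * L ^ 2 - 1) (by linarith)
      nlinarith
    calc Real.exp (1 - 5 * L ^ 2 * n) ≤ Real.exp (n * (1 - 5 * L ^ 2)) :=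
          Real.exp_le_exp.2 (by nlinarith)
      _ = Real.exp (1 - 5 * L ^ 2) ^ n := Real.exp_nat_mul _ _
      _ < (κ : ℝ) ^ n := pow_lt_pow_left₀ hbase (Real.exp_pos _).le hn.ne'
  have hrad : ∀ b : ℝ, b ^ 2 = a ^ 2 →
      radius L (twoPointLaw b κ) n (Real.exp (1 - 5 * L ^ 2 * n)) = L ^ 2 * √5 * σ := by
    intro b hb
    rw [radius, std, var_twoPointLaw, hb, ha2, Real.sqrt_sq hσ.le, one_div, Real.log_inv,
      Real.log_exp]
    have : (1 + -(1 - 5 * L ^ 2 * n)) / n = 5 * L ^ 2 := by field_simp; ring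
    rw [this, Real.sqrt_mul (by norm_num), Real.sqrt_sq hL0.le]
    ring
  rcases le_total 0 m with hm | hm
  · refine ⟨twoPointLaw (-a) κ, twoPointLaw_mem_finiteSecondMoment _ _, ?_, ?_, ?_⟩
    · rw [var_twoPointLaw, neg_sq, ha2]
    · rwa [sampleLaw_twoPointLaw_zero (neg_ne_zero.2 ha0.ne')]
    · rw [hrad _ (neg_sq a), mean_twoPointLaw]
      exact lt_of_lt_of_le (by linarith) (le_abs_self _)
  · refine ⟨twoPointLaw a κ, twoPointLaw_mem_finiteSecondMoment _ _, ?_, ?_, ?_⟩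
    · rw [var_twoPointLaw, ha2]
    · rwa [sampleLaw_twoPointLaw_zero ha0.ne']
    · rw [hrad _ rfl, mean_twoPointLaw]
      exact lt_of_lt_of_le (by linarith) (neg_le_abs _)

lemma not_isDeltaDependentSubGaussian {σ₁ σ₂ L : ℝ} (hσ₁ : 0 < σ₁) (hσ : σ₁ ≤ σ₂) (hL : √2 ≤ L)
    {n : ℕ} (hn : 0 < n) (E : (Fin n → ℝ) × Ico (Real.exp (1 - 5 * L ^ 2 * n)) 1 → ℝ) :
    ¬ IsDeltaDependentSubGaussian L (varianceClass σ₁ σ₂) n (Real.exp (1 - 5 * L ^ 2 * n)) E := by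
  rintro ⟨-, hE⟩
  have hL2 : 2 ≤ L ^ 2 := by
    have := pow_le_pow_left₀ (Real.sqrt_nonneg 2) hL 2
    rwa [Real.sq_sqrt (by norm_num)] at this
  have hn1 : (1 : ℝ) ≤ n := by exact_mod_cast hn
  let δ : Ico (Real.exp (1 - 5 * L ^ 2 * n)) 1 :=
    ⟨Real.exp (1 - 5 * L ^ 2 * n), le_rfl, Real.exp_lt_one_iff.2 (by nlinarith)⟩
  obtain ⟨P, hP, hvar, hmass, hfar⟩ := exists_twoPointLaw_fail hL hσ₁ hn (E (0, δ))
  have hPmem : P ∈ varianceClass σ₁ σ₂ :=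
    ⟨hP, hvar.ge, hvar.trans_le (pow_le_pow_left₀ hσ₁.le hσ 2)⟩
  refine absurd (hE P hPmem δ) (not_le.2 (hmass.trans_le ?_))
  exact measureReal_mono (singleton_subset_iff.2 hfar)

/-! ### Moments of Poisson laws -/

lemma hasSum_poisson_mul_self (r : ℝ≥0) :
    HasSum (fun k : ℕ => Real.exp (-r) * r ^ k / k.factorial * k) r := by
  rw [← hasSum_nat_add_iff' 1]
  simpa using ((hasSum_one_poissonMeasure r).mul_left (r : ℝ)).congr_fun
    fun k => by
      rw [Nat.factorial_succ]; push_cast; field_simp; ring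

lemma hasSum_poisson_mul_sq (r : ℝ≥0) :
    HasSum (fun k : ℕ => Real.exp (-r) * r ^ k / k.factorial * (k : ℝ) ^ 2) (r ^ 2 + r) := by
  rw [← hasSum_nat_add_iff' 1]
  have h := ((hasSum_poisson_mul_self r).add (hasSum_one_poissonMeasure r)).mul_left (r : ℝ)
  have e : (r : ℝ) * (r + 1) = r ^ 2 + r := by ring
  rw [e] at h
  simpa using h.congr_fun fun k => by
    rw [Nat.factorial_succ]; push_cast; field_simp; ring

lemma memLp_natCast_poissonMeasure (r : ℝ≥0) :
    MemLp (fun k : ℕ => (k : ℝ)) 2 (poissonMeasure r) := by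
  refine (memLp_two_iff_integrable_sq (by fun_prop)).2 (integrable_poissonMeasure_iff.2 ?_)
  simpa using (hasSum_poisson_mul_sq r).summable

lemma integral_natCast_poissonMeasure (r : ℝ≥0) : ∫ k : ℕ, (k : ℝ) ∂poissonMeasure r = r := by
  rw [integral_poissonMeasure]
  exact (hasSum_poisson_mul_self r).tsum_eq

lemma variance_natCast_poissonMeasure (r : ℝ≥0) :
    Var[fun k : ℕ => (k : ℝ); poissonMeasure r] = r := by
  have h : ∫ k : ℕ, ((fun k : ℕ => (k : ℝ)) ^ 2) k ∂poissonMeasure r = r ^ 2 + r := by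
    rw [integral_poissonMeasure]
    exact (hasSum_poisson_mul_sq r).tsum_eq
  rw [variance_eq_sub (memLp_natCast_poissonMeasure r), h, integral_natCast_poissonMeasure]
  ring

/-! ### Rescaled Poisson laws and the impossibility of a single estimator for all levels -/

/-- The law of `s • N` for a Poisson variable `N` of rate `r`. -/
noncomputable def scaledPoisson (s : ℝ) (r : ℝ≥0) : ProbabilityMeasure ℝ :=
  ⟨(poissonMeasure r).map fun k : ℕ => s * k, Measure.isProbabilityMeasure_map (by fun_prop)⟩

lemma coe_scaledPoisson (s : ℝ) (r : ℝ≥0) :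
    (scaledPoisson s r : Measure ℝ) = (poissonMeasure r).map fun k : ℕ => s * (k : ℝ) := rfl

lemma scaledPoisson_mem_finiteSecondMoment (s : ℝ) (r : ℝ≥0) :
    scaledPoisson s r ∈ finiteSecondMoment :=
  (memLp_map_measure_iff (by fun_prop) (by fun_prop)).2
    ((memLp_natCast_poissonMeasure r).const_mul s)

lemma mean_scaledPoisson (s : ℝ) (r : ℝ≥0) : mean (scaledPoisson s r) = s * r := by
  rw [mean, coe_scaledPoisson, integral_map (by fun_prop) (by fun_prop), integral_const_mul,
    integral_natCast_poissonMeasure]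

lemma var_scaledPoisson (s : ℝ) (r : ℝ≥0) : var (scaledPoisson s r) = s ^ 2 * r := by
  rw [var, coe_scaledPoisson, variance_map (by fun_prop) (by fun_prop)]
  exact (variance_const_mul s _ _).trans (by rw [variance_natCast_poissonMeasure])

lemma sampleLaw_scaledPoisson (s : ℝ) (r : ℝ≥0) (n : ℕ) :
    sampleLaw (scaledPoisson s r) n =
      (Measure.pi fun _ : Fin n => poissonMeasure r).map fun k i => s * (k i : ℝ) := by
  have (_ : Fin n) : SigmaFinite ((poissonMeasure r).map fun k : ℕ => s * (k : ℝ)) :=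
    inferInstanceAs (SigmaFinite (scaledPoisson s r : Measure ℝ))
  exact (Measure.pi_map_pi (μ := fun _ : Fin n => poissonMeasure r)
    (f := fun _ (k : ℕ) => s * (k : ℝ)) (fun _ => by fun_prop)).symm

lemma measure_le_mul_of_singleton_le {α : Type*} [MeasurableSpace α] [Countable α]
    [MeasurableSingletonClass α] {μ ν : Measure α} {C : ENNReal} {G : Set α}
    (h : ∀ x ∈ G, μ {x} ≤ C * ν {x}) : μ G ≤ C * ν G := by
  have hG : MeasurableSet G := G.to_countable.measurableSet
  rw [← μ.tsum_indicator_apply_singleton G hG, ← ν.tsum_indicator_apply_singleton G hG,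
    ← ENNReal.tsum_mul_left]
  refine ENNReal.tsum_le_tsum fun x => ?_
  by_cases hx : x ∈ G <;> simp [hx, h]

/-- Multiplying the rate of a Poisson law by `c ≥ 1` multiplies the likelihood of the value `k`
by at most `c ^ k`. -/
lemma poissonMeasure_mul_singleton_le (r : ℝ≥0) {c : ℕ} (hc : 1 ≤ c) (k : ℕ) :
    poissonMeasure (c * r) {k} ≤ (c : ENNReal) ^ k * poissonMeasure r {k} := by
  have hc' : (1 : ℝ) ≤ c := by exact_mod_cast hc
  have hcast : (c : ENNReal) ^ k = ENNReal.ofReal ((c : ℝ) ^ k) := by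
    rw [ENNReal.ofReal_pow (by positivity), ENNReal.ofReal_natCast]
  rw [poissonMeasure_singleton, poissonMeasure_singleton, hcast,
    ← ENNReal.ofReal_mul (by positivity)]
  refine ENNReal.ofReal_le_ofReal ?_
  have he : Real.exp (-(c * r : ℝ≥0)) ≤ Real.exp (-r) := by
    refine Real.exp_le_exp.2 (neg_le_neg ?_)
    push_cast
    exact le_mul_of_one_le_left r.2 hc'
  calc Real.exp (-(c * r : ℝ≥0)) * ((c * r : ℝ≥0) : ℝ) ^ k / k.factorial
      ≤ Real.exp (-r) * ((c * r : ℝ≥0) : ℝ) ^ k / k.factorial := by gcongr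
    _ = (c : ℝ) ^ k * (Real.exp (-r) * r ^ k / k.factorial) := by
        push_cast; rw [mul_pow]; ring

lemma pi_poissonMeasure_mul_le (r : ℝ≥0) {c : ℕ} (hc : 1 ≤ c) {n M : ℕ} {G : Set (Fin n → ℕ)}
    (hG : ∀ k ∈ G, ∑ i, k i ≤ M) :
    (Measure.pi fun _ : Fin n => poissonMeasure (c * r)).real G ≤
      (c : ℝ) ^ M * (Measure.pi fun _ : Fin n => poissonMeasure r).real G := by
  have key : (Measure.pi fun _ : Fin n => poissonMeasure (c * r)) G ≤
      (c : ENNReal) ^ M * (Measure.pi fun _ : Fin n => poissonMeasure r) G := by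
    refine measure_le_mul_of_singleton_le fun k hk => ?_
    rw [Measure.pi_singleton, Measure.pi_singleton]
    calc ∏ i, poissonMeasure (c * r) {k i}
        ≤ ∏ i, ((c : ENNReal) ^ k i * poissonMeasure r {k i}) :=
          Finset.prod_le_prod' fun i _ => poissonMeasure_mul_singleton_le r hc (k i)
      _ = (c : ENNReal) ^ (∑ i, k i) * ∏ i, poissonMeasure r {k i} := by
          rw [Finset.prod_mul_distrib, Finset.prod_pow_eq_pow_sum]
      _ ≤ (c : ENNReal) ^ M * ∏ i, poissonMeasure r {k i} := by
          gcongr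
          · exact_mod_cast hc
          · exact hG k hk
  have := ENNReal.toReal_mono (by finiteness) key
  simpa [measureReal_def] using this

lemma pi_poissonMeasure_sum_ge_le {n c : ℕ} (hn : 0 < n) (hc : 0 < c) :
    (Measure.pi fun _ : Fin n => poissonMeasure (c * (n : ℝ≥0)⁻¹)).real
      {k | 2 * c ≤ ∑ i, k i} ≤ 1 / 2 := by
  set r : ℝ≥0 := c * (n : ℝ≥0)⁻¹ with hr
  have hcR : (0 : ℝ) < c := by exact_mod_cast hc
  have hi : Integrable (fun k : ℕ => (k : ℝ)) (poissonMeasure r) :=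
    (memLp_natCast_poissonMeasure r).integrable (by norm_num)
  have hint : ∀ i : Fin n, Integrable (fun k : Fin n → ℕ => (k i : ℝ))
      (Measure.pi fun _ : Fin n => poissonMeasure r) := fun i =>
    (measurePreserving_eval (fun _ : Fin n => poissonMeasure r) i).integrable_comp_of_integrable hi
  have hsum : ∫ k : Fin n → ℕ, ∑ i, (k i : ℝ) ∂(Measure.pi fun _ : Fin n => poissonMeasure r)
      = c := by
    rw [integral_finsetSum _ fun i _ => hint i]
    have (i : Fin n) : ∫ k : Fin n → ℕ, (k i : ℝ) ∂(Measure.pi fun _ : Fin n => poissonMeasure r)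
        = r := by
      rw [integral_comp_eval (μ := fun _ : Fin n => poissonMeasure r) (f := fun k : ℕ => (k : ℝ))
        (by fun_prop), integral_natCast_poissonMeasure]
    rw [Finset.sum_congr rfl fun i _ => this i, Finset.sum_const, Finset.card_univ,
      Fintype.card_fin, nsmul_eq_mul, hr]
    push_cast
    field_simp
  have h : 2 * (c : ℝ) * (Measure.pi fun _ : Fin n => poissonMeasure r).real
      {k | 2 * (c : ℝ) ≤ ∑ i, (k i : ℝ)} ≤ _ := mul_meas_ge_le_integral_of_nonneg
    (Filter.Eventually.of_forall fun k : Fin n → ℕ => Finset.sum_nonneg fun i _ => (k i).cast_nonneg)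
    (integrable_finsetSum _ fun i _ => hint i) (2 * c : ℝ)
  rw [hsum] at h
  have hset : {k : Fin n → ℕ | (2 * c : ℝ) ≤ ∑ i, (k i : ℝ)} = {k | 2 * c ≤ ∑ i, k i} := by
    ext k; simp only [mem_ofPred_eq]; exact_mod_cast Iff.rfl
  rw [hset] at h
  nlinarith

/-- The deviation at level `1/4` under rate `c` and the deviation at level `c^(-2c) / 8` under
rate `1` grow more slowly than the distance `c - 1` of the rates. -/
lemma exists_rate {L : ℝ} (hL : 0 < L) :
    ∃ c : ℕ, 2 ≤ c ∧
      L * √c * √(1 + Real.log 4) + L * √(1 + Real.log (8 * (c : ℝ) ^ (2 * c))) < c - 1 := by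
  obtain ⟨q, hq⟩ := exists_nat_gt (7 * L + 1)
  have hq1 : (1 : ℝ) < q := by linarith
  have hq0 : (0 : ℝ) < q := by linarith
  have hqN : 2 ≤ q := by exact_mod_cast hq1
  -- With `c = q⁸` the three terms have orders `q⁴`, `q⁵` and `q⁸`.
  refine ⟨q ^ 8, hqN.trans (Nat.le_self_pow (by norm_num) q), ?_⟩
  have hpow : ∀ k : ℕ, (1 : ℝ) ≤ (q : ℝ) ^ k := fun k => one_le_pow₀ hq1.le
  have h1 : √((q ^ 8 : ℕ) : ℝ) = (q : ℝ) ^ 4 := by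
    rw [show ((q ^ 8 : ℕ) : ℝ) = ((q : ℝ) ^ 4) ^ 2 by push_cast; ring]
    exact Real.sqrt_sq (by positivity)
  have h2 : √(1 + Real.log 4) ≤ 2 := by
    rw [Real.sqrt_le_left (by norm_num)]
    have := Real.log_le_sub_one_of_pos (x := 4) (by norm_num)
    linarith
  have h3 : √(1 + Real.log (8 * ((q ^ 8 : ℕ) : ℝ) ^ (2 * q ^ 8))) ≤ 5 * (q : ℝ) ^ 5 := by
    rw [Real.sqrt_le_left (by positivity), Real.log_mul (by norm_num) (by positivity),
      Real.log_pow]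
    push_cast
    rw [Real.log_pow]
    have h8 := Real.log_le_sub_one_of_pos (x := 8) (by norm_num)
    have hlq := Real.log_le_sub_one_of_pos hq0
    have h9 : 2 * (q : ℝ) ^ 8 * ((8 : ℕ) * Real.log q) ≤ 16 * (q : ℝ) ^ 9 := by
      have : (q : ℝ) ^ 8 * Real.log q ≤ (q : ℝ) ^ 8 * q := by gcongr; linarith
      push_cast
      nlinarith
    have h10 : (q : ℝ) ^ 9 ≤ (q : ℝ) ^ 10 := pow_le_pow_right₀ hq1.le (by norm_num)
    nlinarith [hpow 9]
  rw [h1]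
  have h45 : (q : ℝ) ^ 4 ≤ (q : ℝ) ^ 5 := pow_le_pow_right₀ hq1.le (by norm_num)
  have h68 : (q : ℝ) ^ 6 ≤ (q : ℝ) ^ 8 := pow_le_pow_right₀ hq1.le (by norm_num)
  have h5 : (1 : ℝ) < (q : ℝ) ^ 5 := one_lt_pow₀ hq1 (by norm_num)
  have h56 : (7 * L + 1) * (q : ℝ) ^ 5 ≤ (q : ℝ) ^ 6 := by
    rw [show (q : ℝ) ^ 6 = q * (q : ℝ) ^ 5 by ring]; gcongr
  calc L * (q : ℝ) ^ 4 * √(1 + Real.log 4)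
        + L * √(1 + Real.log (8 * ((q ^ 8 : ℕ) : ℝ) ^ (2 * q ^ 8)))
      ≤ L * (q : ℝ) ^ 5 * 2 + L * (5 * (q : ℝ) ^ 5) := by gcongr
    _ = 7 * L * (q : ℝ) ^ 5 := by ring
    _ < (q ^ 8 : ℕ) - 1 := by push_cast; linarith

lemma var_scaledPoisson_sqrt (σ : ℝ) {n : ℕ} (hn : 0 < n) (l : ℝ≥0) :
    var (scaledPoisson (σ * √n) (l * (n : ℝ≥0)⁻¹)) = σ ^ 2 * l := by
  rw [var_scaledPoisson, mul_pow, Real.sq_sqrt n.cast_nonneg]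
  push_cast
  field_simp

/-- The deviation for a rescaled Poisson law of rate `l / n`, in units of `σ / √n`. -/
lemma radius_scaledPoisson (L : ℝ) {σ : ℝ} (hσ : 0 < σ) {n : ℕ} (hn : 0 < n) (l : ℝ≥0) (δ : ℝ) :
    radius L (scaledPoisson (σ * √n) (l * (n : ℝ≥0)⁻¹)) n δ =
      L * √l * √(1 + Real.log (1 / δ)) * (σ / √n) := by
  have hn' : (0 : ℝ) < n := by exact_mod_cast hn
  rw [radius, std, var_scaledPoisson_sqrt σ hn, Real.sqrt_mul (by positivity), Real.sqrt_sq hσ.le,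
    Real.sqrt_div' _ hn'.le]
  ring

/-- With `n` observations of rate `c / n`, an estimator has to be close to the corresponding mean
with probability `1/4` while the total count is below `2c`. Lowering the rate to `1 / n` leaves
this event a probability at least `c^(-2c) / 4`, and there the estimator is far from the new
mean. -/
lemma exists_not_isMultipleDeltaSubGaussian {L : ℝ} (hL : √2 ≤ L) :
    ∃ φ : ℝ, 0 < φ ∧ ∃ δmin : ℝ, 0 < δmin ∧ δmin < 1 ∧
      ∀ σ₁ σ₂ : ℝ, 0 < σ₁ → σ₁ ≤ σ₂ → φ < σ₂ / σ₁ → ∀ n : ℕ, 0 < n →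
        ¬ ∃ E : (Fin n → ℝ) → ℝ,
          IsMultipleDeltaSubGaussian L (varianceClass σ₁ σ₂) n δmin E := by
  obtain ⟨c, hc2, hc⟩ := exists_rate (lt_of_lt_of_le (by positivity) hL)
  have hc1 : (1 : ℝ) ≤ c := by exact_mod_cast (by omega : 1 ≤ c)
  have hc0 : (0 : ℝ) < c := by linarith
  set K : ℝ := (c : ℝ) ^ (2 * c) with hK
  have hK1 : 1 ≤ K := one_le_pow₀ hc1
  have hK0 : 0 < K := by linarith
  refine ⟨√c, Real.sqrt_pos.2 hc0, 1 / (8 * K), by positivity,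
    (div_lt_one (by positivity)).2 (by linarith), ?_⟩
  rintro σ₁ σ₂ hσ₁ hσ hφ n hn ⟨E, hE, hdev⟩
  have hn' : (0 : ℝ) < n := by exact_mod_cast hn
  have hcσ : σ₁ ^ 2 * c ≤ σ₂ ^ 2 := by
    have : √c * σ₁ < σ₂ := (lt_div_iff₀ hσ₁).1 hφ
    calc σ₁ ^ 2 * c = (√c * σ₁) ^ 2 := by rw [mul_pow, Real.sq_sqrt hc0.le]; ring
      _ ≤ σ₂ ^ 2 := by gcongr
  set s : ℝ := σ₁ * √n with hs
  have hmem : ∀ l : ℝ≥0, 1 ≤ l → (l : ℝ) ≤ c →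
      scaledPoisson s (l * (n : ℝ≥0)⁻¹) ∈ varianceClass σ₁ σ₂ := by
    intro l h1 h2
    have hvar := var_scaledPoisson_sqrt σ₁ hn l
    refine ⟨scaledPoisson_mem_finiteSecondMoment _ _, ?_, ?_⟩
    · rw [hvar]; exact le_mul_of_one_le_right (by positivity) (by exact_mod_cast h1)
    · rw [hvar]; exact le_trans (by gcongr) hcσ
  have hmean : ∀ l : ℝ≥0, mean (scaledPoisson s (l * (n : ℝ≥0)⁻¹)) = l * (σ₁ / √n) := by
    intro l
    rw [mean_scaledPoisson, hs]
    have : √(n : ℝ) ^ 2 = n := Real.sq_sqrt hn'.le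
    have h0 : √(n : ℝ) ≠ 0 := (Real.sqrt_pos.2 hn').ne'
    push_cast
    field_simp
    rw [this, mul_comm]
  let π : ℝ≥0 → Measure (Fin n → ℕ) := fun r => Measure.pi fun _ : Fin n => poissonMeasure r
  have hmap : ∀ (r : ℝ≥0) (A : Set (Fin n → ℝ)), MeasurableSet A →
      (sampleLaw (scaledPoisson s r) n).real A = (π r).real {k | (fun i => s * (k i : ℝ)) ∈ A} := by
    intro r A hA
    rw [sampleLaw_scaledPoisson, map_measureReal_apply (by fun_prop) hA]
    rfl
  have hmeas : ∀ m r : ℝ, MeasurableSet {x | |E x - m| > r} := fun m r =>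
    measurableSet_lt measurable_const (by fun_prop)
  let P : ℝ≥0 → ProbabilityMeasure ℝ := fun l => scaledPoisson s (l * (n : ℝ≥0)⁻¹)
  let bad : ℝ≥0 → ℝ → Set (Fin n → ℕ) := fun l δ =>
    {k | |E (fun i => s * (k i : ℝ)) - mean (P l)| > radius L (P l) n δ}
  have hbad : ∀ l : ℝ≥0, 1 ≤ l → (l : ℝ) ≤ c → ∀ δ ∈ Ico (1 / (8 * K)) 1,
      (π (l * (n : ℝ≥0)⁻¹)).real (bad l δ) ≤ δ := by
    intro l h1 h2 δ hδ
    have := hdev δ hδ _ (hmem l h1 h2)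
    rwa [hmap _ _ (hmeas _ _)] at this
  have hδK : 1 / (8 * K) ≤ 1 / 4 := by
    rw [div_le_div_iff₀ (by positivity) (by norm_num)]; linarith
  have hbadc := hbad c (by exact_mod_cast (by omega : 1 ≤ c)) (by simp) (1 / 4)
    ⟨hδK, by norm_num⟩
  have hbad1 := hbad 1 le_rfl (by simpa using hc1) (1 / (8 * K)) ⟨le_rfl, by linarith⟩
  have hsum := pi_poissonMeasure_sum_ge_le hn (c := c) (by omega)
  set G : Set (Fin n → ℕ) := (bad c (1 / 4) ∪ {k | 2 * c ≤ ∑ i, k i})ᶜ with hGdef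
  have hG : 1 / 4 ≤ (π (c * (n : ℝ≥0)⁻¹)).real G := by
    rw [hGdef, probReal_compl_eq_one_sub (Set.to_countable _).measurableSet]
    have := measureReal_union_le (μ := π (c * (n : ℝ≥0)⁻¹)) (bad c (1 / 4))
      {k | 2 * c ≤ ∑ i, k i}
    linarith
  have hGK : (π (c * (n : ℝ≥0)⁻¹)).real G ≤ K * (π (1 * (n : ℝ≥0)⁻¹)).real G := by
    rw [one_mul]
    refine pi_poissonMeasure_mul_le _ (by omega) fun k hk => ?_
    by_contra h
    exact hk (Or.inr (by simp only [mem_ofPred_eq]; omega))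
  have hsub : G ⊆ bad 1 (1 / (8 * K)) := by
    intro k hk
    have hk' : ¬ |E (fun i => s * (k i : ℝ)) - mean (P c)| > radius L (P c) n (1 / 4) :=
      fun h => hk (Or.inl h)
    rw [not_lt, hmean, radius_scaledPoisson L hσ₁ hn, one_div_one_div, abs_le] at hk'
    change |E (fun i => s * (k i : ℝ)) - mean (P 1)| > radius L (P 1) n (1 / (8 * K))
    rw [hmean, radius_scaledPoisson L hσ₁ hn, one_div_one_div]
    refine lt_of_lt_of_le ?_ (le_abs_self _)
    have hu : 0 < σ₁ / √n := by positivity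
    have := mul_lt_mul_of_pos_right hc hu
    simp only [NNReal.coe_one, Real.sqrt_one, NNReal.coe_natCast] at hk' ⊢
    linarith [hk'.1]
  have hfin := measureReal_mono (μ := π (1 * (n : ℝ≥0)⁻¹)) hsub
  have : K * (π (1 * (n : ℝ≥0)⁻¹)).real G ≤ K * (1 / (8 * K)) :=
    mul_le_mul_of_nonneg_left (hfin.trans hbad1) hK0.le
  have h8 : K * (1 / (8 * K)) = 1 / 8 := by field_simp
  linarith

/-! ### Medians -/

/-- A median of finitely many reals: the largest `m` such that more than half of the values are at
least `m`. It is encoded as a maximum over strict majorities of the minimum over the majority. -/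
noncomputable def majorityMedian {b : ℕ} [NeZero b] (y : Fin b → ℝ) : ℝ :=
  (Finset.univ : Finset {T : Finset (Fin b) // b < 2 * T.card}).sup'
    ⟨⟨Finset.univ, by have := NeZero.pos b; simp; omega⟩, Finset.mem_univ _⟩
    fun T => T.1.inf' (Finset.card_pos.1 (by have := T.2; omega)) y

lemma measurable_majorityMedian {b : ℕ} [NeZero b] :
    Measurable (majorityMedian : (Fin b → ℝ) → ℝ) := by
  refine Continuous.measurable ?_
  unfold majorityMedian
  exact Continuous.finset_sup'_apply _ fun T _ =>
    Continuous.finset_inf'_apply _ fun i _ => by fun_prop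

/-- If a strict majority of the values is within `η` of `m`, so is the median. -/
lemma abs_majorityMedian_sub_le {b : ℕ} [NeZero b] {y : Fin b → ℝ} {m η : ℝ} {S : Finset (Fin b)}
    (hS : b < 2 * S.card) (h : ∀ i ∈ S, |y i - m| ≤ η) : |majorityMedian y - m| ≤ η := by
  have hne : S.Nonempty := Finset.card_pos.1 (by omega)
  rw [abs_le]
  constructor
  · have h1 : m - η ≤ majorityMedian y := by
      refine le_trans (Finset.le_inf' hne y fun i hi => ?_)
        (Finset.le_sup' (fun T : {T : Finset (Fin b) // b < 2 * T.card} =>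
          T.1.inf' (Finset.card_pos.1 (by have := T.2; omega)) y) (Finset.mem_univ ⟨S, hS⟩))
      linarith [(abs_le.1 (h i hi)).1]
    linarith
  · have h1 : majorityMedian y ≤ m + η := by
      refine Finset.sup'_le _ _ fun T _ => ?_
      -- Two strict majorities share an index.
      obtain ⟨i, hi⟩ : (T.1 ∩ S).Nonempty := by
        rw [← Finset.card_pos]
        have h1 := Finset.card_union_add_card_inter T.1 S
        have h2 := Finset.card_le_univ (T.1 ∪ S)
        have h3 := T.2
        rw [Fintype.card_fin] at h2
        omega
      refine (Finset.inf'_le y (Finset.mem_inter.1 hi).1).trans ?_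
      linarith [(abs_le.1 (h i (Finset.mem_inter.1 hi).2)).2]
    linarith

/-! ### Medians of means -/

/-- A product probability whose index set contains `b` disjoint blocks of length `N` makes the
blocks independent, each with a product law. -/
lemma map_sampleLaw_blocks (P : ProbabilityMeasure ℝ) {n b N : ℕ} {e : Fin b × Fin N → Fin n}
    (he : e.Injective) :
    (sampleLaw P n).map (fun x (j : Fin b) (k : Fin N) => x (e (j, k))) =
      Measure.pi fun _ : Fin b => sampleLaw P N := by
  have hflat : (sampleLaw P n).map (fun x p => x (e p)) =
      Measure.pi fun _ : Fin b × Fin N => (P : Measure ℝ) := by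
    have hind : iIndepFun (fun (i : Fin n) (x : Fin n → ℝ) => x i) (sampleLaw P n) :=
      iIndepFun_pi (μ := fun _ : Fin n => (P : Measure ℝ)) (X := fun _ => id)
        fun _ => aemeasurable_id
    rw [(hind.precomp he).map_fun_eq_pi_map fun _ => (measurable_pi_apply _).aemeasurable]
    congr 1
    ext1 p
    exact (measurePreserving_eval (fun _ : Fin n => (P : Measure ℝ)) (e p)).map_eq
  have hcurry : (Measure.pi fun _ : Fin b => sampleLaw P N).map
      (fun z (p : Fin b × Fin N) => z p.1 p.2) =
      Measure.pi fun _ : Fin b × Fin N => (P : Measure ℝ) := by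
    refine (Measure.pi_eq fun s hs => ?_).symm
    rw [Measure.map_apply (by fun_prop) (MeasurableSet.univ_pi hs)]
    have : (fun (z : Fin b → Fin N → ℝ) (p : Fin b × Fin N) => z p.1 p.2) ⁻¹' univ.pi s =
        univ.pi fun j => univ.pi fun k => s (j, k) := by
      ext z; simp [Set.mem_pi]
    rw [this, Measure.pi_pi, Fintype.prod_prod_type]
    simp [sampleLaw, Measure.pi_pi]
  have huncurry : Measurable fun (w : Fin b × Fin N → ℝ) j k => w (j, k) := by fun_prop
  have h := congrArg (Measure.map fun (w : Fin b × Fin N → ℝ) j k => w (j, k))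
    (hflat.trans hcurry.symm)
  rw [Measure.map_map huncurry (by fun_prop), Measure.map_map huncurry (by fun_prop)] at h
  exact h.trans Measure.map_id

/-- Chebyshev's inequality for the empirical mean. -/
lemma sampleLaw_abs_average_sub_mean_le {P : ProbabilityMeasure ℝ} (hP : P ∈ finiteSecondMoment)
    {N : ℕ} (hN : 0 < N) {η : ℝ} (hη : 0 < η) :
    (sampleLaw P N).real {x | η < |(∑ k, x k) / N - mean P|} ≤ var P / (N * η ^ 2) := by
  have hN' : (0 : ℝ) < N := by exact_mod_cast hN
  have hX : ∀ k : Fin N, MemLp (fun x : Fin N → ℝ => x k) 2 (sampleLaw P N) := fun k =>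
    MemLp.comp_measurePreserving hP
      (measurePreserving_eval (fun _ : Fin N => (P : Measure ℝ)) k)
  have hsum : MemLp (fun x : Fin N → ℝ => ∑ k, x k) 2 (sampleLaw P N) :=
    memLp_finsetSum _ fun k _ => hX k
  have hint : ∫ x, ∑ k, x k ∂sampleLaw P N = N * mean P := by
    rw [integral_finsetSum _ fun k _ => (hX k).integrable (by norm_num)]
    have (k : Fin N) : ∫ x, x k ∂sampleLaw P N = mean P :=
      integral_comp_eval (μ := fun _ : Fin N => (P : Measure ℝ)) (f := fun t : ℝ => t)
        (by fun_prop)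
    simp [this]
  have hvar : Var[fun x => ∑ k, x k; sampleLaw P N] = N * var P := by
    have := variance_sum_pi (μ := fun _ : Fin N => (P : Measure ℝ)) (X := fun _ t => t)
      fun _ => hP
    rw [Finset.sum_fn] at this
    rw [sampleLaw, this]
    simp [var]
  have h := meas_ge_le_variance_div_sq hsum (mul_pos hN' hη)
  rw [hint, hvar] at h
  have h' := ENNReal.toReal_mono ENNReal.ofReal_ne_top h
  have hv : 0 ≤ var P := variance_nonneg _ _
  rw [ENNReal.toReal_ofReal (by positivity)] at h'
  calc (sampleLaw P N).real {x | η < |(∑ k, x k) / N - mean P|}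
      ≤ (sampleLaw P N).real {x | N * η ≤ |∑ k, x k - N * mean P|} := by
        refine measureReal_mono fun x hx => ?_
        have e : ∑ k, x k - N * mean P = N * ((∑ k, x k) / N - mean P) := by field_simp
        simp only [mem_ofPred_eq] at hx ⊢
        rw [e, abs_mul, abs_of_pos hN']
        gcongr
    _ ≤ N * var P / (N * η) ^ 2 := h'
    _ = var P / (N * η ^ 2) := by field_simp

/-- If each of `b` independent events has probability at most `1 / (4 e²)`, at least half of them
occur with probability at most `e⁻ᵇ`: there are at most `2ᵇ` ways to choose the events that occur,
and each choice of at least `b / 2` of them costs a factor `(2 e)⁻ᵇ`. -/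
lemma pi_half_le_exp_neg {α : Type*} [MeasurableSpace α] {ν : Measure α} [IsProbabilityMeasure ν]
    {B : Set α} (hB : ν.real B ≤ ((2 * Real.exp 1)⁻¹) ^ 2) (b : ℕ) :
    (Measure.pi fun _ : Fin b => ν).real
      {z | ∃ S : Finset (Fin b), b ≤ 2 * S.card ∧ ∀ j ∈ S, z j ∈ B} ≤ Real.exp (-b) := by
  classical
  set q : ℝ := (2 * Real.exp 1)⁻¹ with hq
  have hq0 : 0 ≤ q := by positivity
  have hq1 : q ≤ 1 := inv_le_one_of_one_le₀ (by linarith [Real.add_one_le_exp 1])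
  let F : Finset (Finset (Fin b)) := Finset.univ.filter fun S => b ≤ 2 * S.card
  have hset : {z : Fin b → α | ∃ S : Finset (Fin b), b ≤ 2 * S.card ∧ ∀ j ∈ S, z j ∈ B} =
      ⋃ S ∈ F, {z | ∀ j ∈ S, z j ∈ B} := by
    ext z; simp [F]
  have hone : ∀ S ∈ F, (Measure.pi fun _ : Fin b => ν).real {z | ∀ j ∈ S, z j ∈ B} ≤ q ^ b := by
    intro S hS
    have hSc : b ≤ 2 * S.card := by simpa [F] using hS
    have hbox : {z : Fin b → α | ∀ j ∈ S, z j ∈ B} =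
        univ.pi fun j => if j ∈ S then B else univ := by
      ext z
      simp only [mem_ofPred_eq, Set.mem_pi, mem_univ, forall_true_left]
      exact forall_congr' fun j => by by_cases hj : j ∈ S <;> simp [hj]
    rw [hbox, measureReal_def, Measure.pi_pi, ENNReal.toReal_prod]
    calc ∏ j, (ν (if j ∈ S then B else univ)).toReal
        = ∏ j, (if j ∈ S then ν.real B else 1) := by
          refine Finset.prod_congr rfl fun j _ => ?_
          by_cases hj : j ∈ S <;> simp [hj, measureReal_def]
      _ = ν.real B ^ S.card := by simp
      _ ≤ (q ^ 2) ^ S.card := by gcongr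
      _ = q ^ (2 * S.card) := (pow_mul _ _ _).symm
      _ ≤ q ^ b := pow_le_pow_of_le_one hq0 hq1 hSc
  rw [hset]
  calc (Measure.pi fun _ : Fin b => ν).real (⋃ S ∈ F, {z | ∀ j ∈ S, z j ∈ B})
      ≤ ∑ S ∈ F, (Measure.pi fun _ : Fin b => ν).real {z | ∀ j ∈ S, z j ∈ B} :=
        measureReal_biUnion_finset_le _ _
    _ ≤ ∑ S ∈ F, q ^ b := Finset.sum_le_sum hone
    _ = F.card * q ^ b := by rw [Finset.sum_const, nsmul_eq_mul]
    _ ≤ 2 ^ b * q ^ b := by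
        gcongr
        have : F.card ≤ 2 ^ b := (Finset.card_le_univ F).trans (by simp)
        exact_mod_cast this
    _ = Real.exp (-b) := by
        rw [← mul_pow, hq, mul_inv, mul_inv_cancel_left₀ (by norm_num), ← Real.exp_neg,
          ← Real.exp_nat_mul]
        simp

/-- The half-width of the confidence interval of a median of `b` means at level `e⁻ᵇ`. -/
noncomputable def medianRadius (σ : ℝ) (n b : ℕ) : ℝ :=
  2 * Real.exp 1 * σ * √(2 * b / n)

/-- The median of the means of `b` blocks of length `⌊n / b⌋`. -/
lemma exists_medianOfMeans {σ : ℝ} (hσ : 0 < σ) {n b : ℕ} (hb : 0 < b) (hbn : b ≤ n) :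
    ∃ M : (Fin n → ℝ) → ℝ, Measurable M ∧ ∀ P ∈ finiteSecondMoment, var P ≤ σ ^ 2 →
      (sampleLaw P n).real {x | medianRadius σ n b < |M x - mean P|} ≤ Real.exp (-b) := by
  have : NeZero b := ⟨hb.ne'⟩
  have hb' : (0 : ℝ) < b := by exact_mod_cast hb
  have hn' : (0 : ℝ) < n := by exact_mod_cast hb.trans_le hbn
  set N : ℕ := n / b with hNdef
  have hN : 0 < N := Nat.div_pos hbn hb
  have hN' : (0 : ℝ) < N := by exact_mod_cast hN
  have hbN : b * N ≤ n := Nat.mul_div_le n b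
  have hnN : (n : ℝ) ≤ 2 * b * N := by
    have h1 : n < b * (N + 1) := Nat.lt_mul_div_succ n hb
    have h2 : n ≤ 2 * b * N := by nlinarith
    exact_mod_cast h2
  let e : Fin b × Fin N → Fin n := fun p => Fin.castLE hbN (finProdFinEquiv p)
  have he : e.Injective := (Fin.castLE_injective hbN).comp finProdFinEquiv.injective
  let M : (Fin n → ℝ) → ℝ := fun x => majorityMedian fun j : Fin b => (∑ k, x (e (j, k))) / N
  have hη : 0 < medianRadius σ n b := by unfold medianRadius; positivity
  refine ⟨M, measurable_majorityMedian.comp (by fun_prop), fun P hP hvar => ?_⟩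
  let B : Set (Fin N → ℝ) := {y | medianRadius σ n b < |(∑ k, y k) / N - mean P|}
  have hBm : MeasurableSet B := measurableSet_lt measurable_const (by fun_prop)
  have hB : (sampleLaw P N).real B ≤ ((2 * Real.exp 1)⁻¹) ^ 2 := by
    refine (sampleLaw_abs_average_sub_mean_le hP hN hη).trans ?_
    have hsq : medianRadius σ n b ^ 2 = (2 * Real.exp 1) ^ 2 * σ ^ 2 * (2 * b / n) := by
      rw [medianRadius, mul_pow, mul_pow, Real.sq_sqrt (by positivity)]
    have h1 : 1 ≤ N * (2 * b / n : ℝ) := by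
      rw [mul_div_assoc', le_div_iff₀ hn']; linarith
    rw [div_le_iff₀ (by positivity), hsq]
    calc var P ≤ σ ^ 2 * 1 := by rwa [mul_one]
      _ ≤ σ ^ 2 * (N * (2 * b / n : ℝ)) := by gcongr
      _ = (2 * Real.exp 1)⁻¹ ^ 2 * (N * ((2 * Real.exp 1) ^ 2 * σ ^ 2 * (2 * b / n))) := by
          field_simp
  have hT : MeasurableSet
      {z : Fin b → Fin N → ℝ | ∃ S : Finset (Fin b), b ≤ 2 * S.card ∧ ∀ j ∈ S, z j ∈ B} := by
    simp only [Set.ofPred_exists, Set.ofPred_and, Set.ofPred_forall]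
    refine MeasurableSet.iUnion fun S => (MeasurableSet.const _).inter ?_
    exact MeasurableSet.iInter fun j => MeasurableSet.iInter fun _ =>
      (measurable_pi_apply j) hBm
  have hbound := pi_half_le_exp_neg hB b
  rw [← map_sampleLaw_blocks P he, map_measureReal_apply (by fun_prop) hT] at hbound
  refine (measureReal_mono fun x hx => ?_).trans hbound
  -- If fewer than half of the blocks were bad, the median would be close to the mean.
  classical
  by_contra hcon
  let S : Finset (Fin b) := Finset.univ.filter fun j => (fun k => x (e (j, k))) ∈ B
  have hS : 2 * S.card < b := by
    by_contra hS
    exact hcon ⟨S, not_lt.1 hS, fun j hj => (Finset.mem_filter.1 hj).2⟩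
  have hSc : b < 2 * Sᶜ.card := by
    rw [Finset.card_compl, Fintype.card_fin]; omega
  refine absurd (abs_majorityMedian_sub_le hSc fun j hj => ?_) (not_le.2 hx)
  have : ¬ (fun k => x (e (j, k))) ∈ B := by simpa [S] using hj
  exact not_lt.1 this

/-! ### Combining confidence intervals into one estimator for all levels -/

/-- The point obtained from `0` by projecting successively onto the intervals
`[M j - η j, M j + η j]` for `j = 1, …, n`. -/
noncomputable def projectionChain (M η : ℕ → ℝ) : ℕ → ℝ
  | 0 => 0
  | j + 1 => max (M (j + 1) - η (j + 1)) (min (M (j + 1) + η (j + 1)) (projectionChain M η j))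

/-- If the intervals from the `b`-th on all contain `m`, the chain ends within twice the half-width
of the `b`-th interval: it enters that interval at step `b`, and a projection onto an interval
containing `m` does not increase the distance to `m`. -/
lemma abs_projectionChain_sub_le {M η : ℕ → ℝ} {m : ℝ} {b n : ℕ} (hb : 0 < b) (hbn : b ≤ n)
    (h : ∀ j, b ≤ j → j ≤ n → |M j - m| ≤ η j) : |projectionChain M η n - m| ≤ 2 * η b := by
  induction n, hbn using Nat.le_induction with
  | base =>
    obtain ⟨b, rfl⟩ := Nat.exists_eq_add_of_lt hb
    have h0 := abs_le.1 (h _ le_rfl le_rfl)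
    simp only [zero_add] at *
    rw [projectionChain, abs_le]
    constructor
    · have := le_max_left (M (b + 1) - η (b + 1))
        (min (M (b + 1) + η (b + 1)) (projectionChain M η b))
      linarith
    · have : max (M (b + 1) - η (b + 1))
          (min (M (b + 1) + η (b + 1)) (projectionChain M η b)) ≤ M (b + 1) + η (b + 1) :=
        max_le (by linarith) (min_le_left _ _)
      linarith
  | succ n hbn ih =>
    have h1 := abs_le.1 (ih fun j hj hjn => h j hj (by omega))
    have h2 := abs_le.1 (h (n + 1) (by omega) le_rfl)
    have h3 := abs_nonneg (projectionChain M η n - m)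
    rw [projectionChain, abs_le]
    constructor
    · rcases le_total (M (n + 1) + η (n + 1)) (projectionChain M η n) with hc | hc
      · have := le_max_right (M (n + 1) - η (n + 1))
          (min (M (n + 1) + η (n + 1)) (projectionChain M η n))
        rw [min_eq_left hc] at this ⊢
        linarith
      · have := le_max_right (M (n + 1) - η (n + 1))
          (min (M (n + 1) + η (n + 1)) (projectionChain M η n))
        rw [min_eq_right hc] at this ⊢
        linarith
    · have : max (M (n + 1) - η (n + 1))
          (min (M (n + 1) + η (n + 1)) (projectionChain M η n)) ≤ m + 2 * η b :=
        max_le (by linarith) ((min_le_right _ _).trans (by linarith))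
      linarith

lemma measurable_projectionChain {α : Type*} [MeasurableSpace α] {M : ℕ → α → ℝ}
    (hM : ∀ j, Measurable (M j)) (η : ℕ → ℝ) (n : ℕ) :
    Measurable fun x => projectionChain (fun j => M j x) η n := by
  induction n with
  | zero => exact measurable_const
  | succ n ih =>
    exact ((hM _).sub_const _).max (((hM _).add_const _).min ih)

lemma sum_exp_neg_Ico_le (b n : ℕ) :
    ∑ j ∈ Finset.Ico b n, Real.exp (-j) ≤ 2 * Real.exp (-b) := by
  have hq : Real.exp (-1) ≤ 1 / 2 := by
    rw [Real.exp_neg, one_div]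
    exact inv_anti₀ (by norm_num) (by linarith [Real.add_one_le_exp 1])
  have he : ∀ j : ℕ, Real.exp (-j) = Real.exp (-1) ^ j := fun j => by
    rw [← Real.exp_nat_mul]; simp
  simp only [he]
  refine (geom_sum_Ico_le_of_lt_one (Real.exp_pos _).le (by linarith)).trans ?_
  rw [div_le_iff₀ (by linarith)]
  have := pow_pos (Real.exp_pos (-1)) b
  nlinarith

/-- Twice the half-width of the `b`-th interval, with `b ≈ ln (2 / δ)` blocks, is within the
deviation at level `δ`. -/
lemma two_mul_medianRadius_le_radius {σ₁ σ₂ δ : ℝ} (hσ₁ : 0 < σ₁) (hσ : σ₁ ≤ σ₂)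
    (hδ0 : 0 < δ) (hδ1 : δ < 1) {P : ProbabilityMeasure ℝ} (hP : σ₁ ^ 2 ≤ var P) {n b : ℕ}
    (hb : (b : ℝ) < Real.log (2 / δ) + 1) :
    2 * medianRadius σ₂ n b ≤
      radius ((4 * Real.exp 1 * √(2 + 4 * Real.log 2)) * (σ₂ / σ₁)) P n δ := by
  have hlog2 : 0 ≤ Real.log 2 := Real.log_nonneg (by norm_num)
  have hl : 0 ≤ Real.log (1 / δ) :=
    Real.log_nonneg (by rw [one_div]; exact (one_le_inv₀ hδ0).2 hδ1.le)
  have hstd : σ₁ ≤ std P := Real.le_sqrt_of_sq_le hP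
  have hσ₂ : 0 < σ₂ := hσ₁.trans_le hσ
  have hsplit : Real.log (2 / δ) = Real.log 2 + Real.log (1 / δ) := by
    rw [← Real.log_mul (by norm_num) (by positivity)]; congr 1; ring
  have hsqrt : √(2 * b / n) ≤ √(2 + 4 * Real.log 2) * √((1 + Real.log (1 / δ)) / n) := by
    rw [← Real.sqrt_mul (by positivity), mul_div_assoc']
    refine Real.sqrt_le_sqrt (div_le_div_of_nonneg_right ?_ n.cast_nonneg)
    nlinarith [mul_nonneg hlog2 hl]
  calc 2 * medianRadius σ₂ n b = 4 * Real.exp 1 * σ₂ * √(2 * b / n) := by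
        rw [medianRadius]; ring
    _ ≤ 4 * Real.exp 1 * σ₂ * (√(2 + 4 * Real.log 2) * √((1 + Real.log (1 / δ)) / n)) := by
        gcongr
    _ = (4 * Real.exp 1 * √(2 + 4 * Real.log 2)) * (σ₂ / σ₁) * σ₁
          * √((1 + Real.log (1 / δ)) / n) := by field_simp
    _ ≤ _ := by rw [radius]; gcongr

lemma exists_isMultipleDeltaSubGaussian {σ₁ σ₂ : ℝ} (hσ₁ : 0 < σ₁) (hσ : σ₁ ≤ σ₂) (n : ℕ) :
    ∃ E : (Fin n → ℝ) → ℝ,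
      IsMultipleDeltaSubGaussian ((4 * Real.exp 1 * √(2 + 4 * Real.log 2)) * (σ₂ / σ₁))
        (varianceClass σ₁ σ₂) n (4 * Real.exp (1 - (n : ℝ) / 2)) E := by
  have hex : ∀ b : ℕ, ∃ M : (Fin n → ℝ) → ℝ, Measurable M ∧ (0 < b → b ≤ n →
      ∀ P ∈ finiteSecondMoment, var P ≤ σ₂ ^ 2 → (sampleLaw P n).real
        {x | medianRadius σ₂ n b < |M x - mean P|} ≤ Real.exp (-b)) := by
    intro b
    by_cases h : 0 < b ∧ b ≤ n
    · obtain ⟨M, hM, hM'⟩ := exists_medianOfMeans (hσ₁.trans_le hσ) h.1 h.2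
      exact ⟨M, hM, fun _ _ => hM'⟩
    · exact ⟨0, measurable_const, fun h1 h2 => absurd ⟨h1, h2⟩ h⟩
  choose M hM hdev using hex
  refine ⟨fun x => projectionChain (fun j => M j x) (medianRadius σ₂ n) n,
    measurable_projectionChain hM _ n, fun δ hδ P hP => ?_⟩
  have hδ0 : 0 < δ := lt_of_lt_of_le (by positivity) hδ.1
  have hlog0 : 0 < Real.log (2 / δ) :=
    Real.log_pos ((one_lt_div hδ0).2 (by linarith [hδ.2]))
  set b : ℕ := ⌈Real.log (2 / δ)⌉₊ with hb
  have hb0 : 0 < b := Nat.ceil_pos.2 hlog0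
  have hb1 : (b : ℝ) < Real.log (2 / δ) + 1 := Nat.ceil_lt_add_one hlog0.le
  have hbn : b ≤ n := by
    have h1 : Real.log (2 / δ) ≤ n / 2 - 1 := by
      have h2 : 2 / δ ≤ Real.exp (n / 2 - 1) := by
        rw [div_le_iff₀ hδ0]
        have h3 : Real.exp ((n : ℝ) / 2 - 1) * Real.exp (1 - (n : ℝ) / 2) = 1 := by
          rw [← Real.exp_add]; simp
        nlinarith [mul_le_mul_of_nonneg_left hδ.1 (Real.exp_pos ((n : ℝ) / 2 - 1)).le]
      exact (Real.log_le_iff_le_exp (by positivity)).2 h2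
    have : (b : ℝ) ≤ n := by linarith [(n.cast_nonneg : (0 : ℝ) ≤ n)]
    exact_mod_cast this
  have hlevel : 2 * Real.exp (-b) ≤ δ := by
    have h1 : Real.exp (-b) ≤ Real.exp (-Real.log (2 / δ)) :=
      Real.exp_le_exp.2 (neg_le_neg (Nat.le_ceil _))
    rw [Real.exp_neg (Real.log _), Real.exp_log (by positivity), inv_div] at h1
    linarith
  calc (sampleLaw P n).real _
      ≤ (sampleLaw P n).real (⋃ j ∈ Finset.Ico b (n + 1),
          {x | medianRadius σ₂ n j < |M j x - mean P|}) := by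
        refine measureReal_mono (fun x hx => ?_) (measure_ne_top _ _)
        by_contra hcon
        simp only [mem_iUnion, not_exists, Finset.mem_Ico, mem_ofPred_eq, not_lt] at hcon
        refine absurd ((abs_projectionChain_sub_le hb0 hbn fun j h1 h2 =>
          hcon j ⟨h1, by omega⟩).trans ?_) (not_le.2 hx)
        exact two_mul_medianRadius_le_radius hσ₁ hσ hδ0 hδ.2 hP.2.1 hb1
    _ ≤ ∑ j ∈ Finset.Ico b (n + 1),
          (sampleLaw P n).real {x | medianRadius σ₂ n j < |M j x - mean P|} :=
        measureReal_biUnion_finset_le _ _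
    _ ≤ ∑ j ∈ Finset.Ico b (n + 1), Real.exp (-j) := by
        refine Finset.sum_le_sum fun j hj => ?_
        rw [Finset.mem_Ico] at hj
        exact hdev j (by omega) (by omega) P hP.1 hP.2.2
    _ ≤ δ := (sum_exp_neg_Ico_le _ _).trans hlevel

end SubGaussianMean

theorem theorem2 :
    -- (1) a multiple-`δ` estimator, with a constant proportional to `R = σ₂ / σ₁`
    (∀ σ₁ σ₂ : ℝ, 0 < σ₁ → σ₁ ≤ σ₂ → ∀ n : ℕ, 6 ≤ n →
      ∃ E : (Fin n → ℝ) → ℝ,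
        SubGaussianMean.IsMultipleDeltaSubGaussian
          ((4 * Real.exp 1 * √(2 + 4 * Real.log 2)) * (σ₂ / σ₁))
          (SubGaussianMean.varianceClass σ₁ σ₂) n (4 * Real.exp (1 - (n : ℝ) / 2)) E) ∧
    -- (2) no multiple-`δ` estimator when `R` exceeds a threshold that depends only on `L`
    (∀ L : ℝ, √2 ≤ L → ∃ φ : ℝ, 0 < φ ∧ ∃ δmin : ℝ, 0 < δmin ∧ δmin < 1 ∧
      ∀ σ₁ σ₂ : ℝ, 0 < σ₁ → σ₁ ≤ σ₂ → φ < σ₂ / σ₁ → ∀ n : ℕ, 0 < n →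
        ¬ ∃ E : (Fin n → ℝ) → ℝ,
          SubGaussianMean.IsMultipleDeltaSubGaussian L
            (SubGaussianMean.varianceClass σ₁ σ₂) n δmin E) ∧
    -- (3) no `δ`-dependent estimator down to `δmin = exp (1 - 5 L² n)`
    (∀ σ₁ σ₂ : ℝ, 0 < σ₁ → σ₁ ≤ σ₂ → ∀ L : ℝ, √2 ≤ L → ∀ n : ℕ, 0 < n →
      ¬ ∃ E : (Fin n → ℝ) × Set.Ico (Real.exp (1 - 5 * L ^ 2 * n)) 1 → ℝ,
        SubGaussianMean.IsDeltaDependentSubGaussian L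
          (SubGaussianMean.varianceClass σ₁ σ₂) n (Real.exp (1 - 5 * L ^ 2 * n)) E) :=
  ⟨fun _ _ hσ₁ hσ n _ => SubGaussianMean.exists_isMultipleDeltaSubGaussian hσ₁ hσ n,
    fun _ hL => SubGaussianMean.exists_not_isMultipleDeltaSubGaussian hL,
    fun _ _ hσ₁ hσ _ hL _ hn =>
      not_exists.2 (SubGaussianMean.not_isDeltaDependentSubGaussian hσ₁ hσ hL hn)⟩
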